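/- All logarithms are to base $2$. For a graph $H$ and a real number $x$ let $\mathrm{RT}(n,H,x)$ be the maximum number of edges of an $H$-free (simple) graph on $n$ vertices with independence number less than $x$ (and $0$ if there is no such graph). For $f:\mathbb N\to\mathbb R$ put $$\overline{\varrho}(H,f)=\limsup_{n\to\infty}\frac{\mathrm{RT}(n,H,f(n))}{n^2},\qquad \underline{\varrho}(H,f)=\liminf_{n\to\infty}\frac{\mathrm{RT}(n,H,f(n))}{n^2}.$$ For functions $g\le f$, say that $H$ has a *phase transition from $f$ to $g$* if $\overline{\varrho}(H,g)<\underline{\varrho}(H,f)$. For $\varphi(n)\to 0$, say that $H$ has a *$\varphi$-phase-transition at $f$* if $H$ has a phase transition from $f$ to $\varphi f$. Say that $H$ has a *weak phase transition at $f$* if there is an $\varepsilon>0$ such that $\varphi_\varepsilon(n)=2^{-(\log n)^{1-\varepsilon}}$ tends to $0$ (that is, $0<\varepsilon<1$) and $H$ has a $\varphi_\varepsilon$-phase-transition at $f$. For integers $t\ge 2$ and $n$ let $Q(t,n)$ be the minimum independence number of a $K_t$-free graph on $n$ vertices. **Theorem.** Let $s$ and $t\ge 2$ be natural numbers. If $K_s$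 has a phase transition from $Q(t,n)$ to $Q(t+1,n)$, then $K_s$ has a weak phase transition at $Q(t,n)$; that is, there is an $\varepsilon>0$ for which $K_s$ has a $\varphi_\varepsilon$-phase-transition at $Q(t,n)$. -/

import Mathlib

open Filter Topology

noncomputable section

namespace RamseyTuran

/-- The Ramsey-Turán number: the maximum number of edges of an `H`-free graph on `n` vertices
whose independence number is less than `x`. It is `0` if there is no such graph. -/
def rtNumber {W : Type} (n : ℕ) (H : SimpleGraph W) (x : ℝ) : ℕ :=
  sSup {m : ℕ | ∃ G : SimpleGraph (Fin n),
    H.Free G ∧ (G.indepNum : ℝ) < x ∧ G.edgeSet.ncard = m}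

/-- The upper Ramsey-Turán density of `H` with respect to `f`. -/
def upperDensity {W : Type} (H : SimpleGraph W) (f : ℕ → ℝ) : ℝ :=
  limsup (fun n : ℕ => (rtNumber n H (f n) : ℝ) / (n : ℝ) ^ 2) atTop

/-- The lower Ramsey-Turán density of `H` with respect to `f`. -/
def lowerDensity {W : Type} (H : SimpleGraph W) (f : ℕ → ℝ) : ℝ :=
  liminf (fun n : ℕ => (rtNumber n H (f n) : ℝ) / (n : ℝ) ^ 2) atTop

/-- The inverse Ramsey function `Q(t, n)`: the minimum independence number of a
`K_t`-free graph on `n` vertices. -/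
def ramseyInv (t n : ℕ) : ℕ :=
  sInf {a : ℕ | ∃ G : SimpleGraph (Fin n), G.CliqueFree t ∧ G.indepNum = a}

/-- `H` has a phase transition from `f` to `g`, where `g ≤ f`. -/
def HasPhaseTransition {W : Type} (H : SimpleGraph W) (f g : ℕ → ℝ) : Prop :=
  (∀ n, g n ≤ f n) ∧ upperDensity H g < lowerDensity H f

/-- `H` has a `φ`-phase-transition at `f`, where `φ` tends to `0`. -/
def HasPhaseTransitionAt {W : Type} (H : SimpleGraph W) (φ f : ℕ → ℝ) : Prop :=
  Tendsto φ atTop (𝓝 0) ∧ HasPhaseTransition H f (fun n => φ n * f n)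

/-- The function `φ_ε(n) = 2 ^ (-(log₂ n) ^ (1 - ε))`. -/
def weakScale (ε : ℝ) (n : ℕ) : ℝ :=
  (2 : ℝ) ^ (-(Real.logb 2 (n : ℝ)) ^ (1 - ε))

/-- `H` has a weak phase transition at `f`. Since `φ_ε` has to tend to `0`, only `ε < 1` counts. -/
def HasWeakPhaseTransition {W : Type} (H : SimpleGraph W) (f : ℕ → ℝ) : Prop :=
  ∃ ε : ℝ, 0 < ε ∧ HasPhaseTransitionAt H (weakScale ε) f

end RamseyTuran

end

namespace RamseyTuran

open Finset SimpleGraph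

/-! If `s ≤ t`, a `K_s`-free graph is `K_t`-free, so the lower density at `Q(t,n)` is `0` and no
transition starts there. Otherwise put `r = ⌊(s-1)/t⌋`, so that `rt < s ≤ (r+1)t`. The value `(1 -
1/r)/2` separates the scales: it bounds the upper density at `φ_ε Q(t,n)` from above and that at
`Q(t+1,n)` from below, and the latter lies below the lower density at `Q(t,n)` by hypothesis.

The lower bound (`le_upperDensity_ramseyInv_succ`) joins `r` optimal `K_{t+1}`-free graphs
completely: cliques have at most `rt` vertices, and independent sets stay inside one part.

For the upper bound (`upperDensity_weakScale_le`), more edges would force a positive proportion of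
ordered `(r+1)`-cliques (`pow_mul_le_card_cliqueTuples`). Iterated dependent random choice
(`eventually_exists_product`) then finds `r+1` completely joined `t`-cliques, a `K_{(r+1)t}`. The
`t`-cliques exist because a large `K_t`-free vertex set, copied until it has `n` vertices, would
beat `Q(t,n)` (`exists_clique_subset`). -/

/-! ### Ramsey's theorem and growth of the inverse Ramsey function -/

/-- A quantitative form of Ramsey's theorem: the order of a graph is bounded in terms of its
clique number and its independence number. -/
theorem exists_card_le_of_cliqueFreeOn (t a : ℕ) : ∃ N : ℕ, ∀ {V : Type} [Finite V]
    (G : SimpleGraph V) (A : Finset V), G.CliqueFreeOn A t → G.indepNum ≤ a → A.card ≤ N := by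
  classical
  induction t with
  | zero => exact ⟨0, fun G A h _ => 
      absurd (by simp [isNClique_iff]) (h (t := ∅) (by simp))⟩
  | succ t ih =>
    obtain ⟨N, hN⟩ := ih
    refine ⟨a + a * N, fun {V} _ G A hA ha => ?_⟩
    obtain ⟨I, hI, hmax⟩ :=
      (A.powerset.filter fun I : Finset V => G.IsIndepSet (I : Set V)).exists_max_image
        Finset.card ⟨∅, by simp [IsIndepSet]⟩
    simp only [mem_filter, mem_powerset] at hI hmax
    -- By maximality `I` dominates `A`, and each neighbourhood inside `A` has no `t`-clique.
    have hsub : A ⊆ I ∪ I.biUnion fun i => A.filter (G.Adj i) := by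
      intro x hx
      by_contra hcon
      simp only [mem_union, mem_biUnion, mem_filter, not_or, not_exists, not_and] at hcon
      have := hmax (insert x I) ⟨insert_subset hx hI.1, by
        rw [coe_insert, isIndepSet_iff]
        refine hI.2.insert fun y hy _ => ⟨fun h => hcon.2 y hy hx h.symm, hcon.2 y hy hx⟩⟩
      rw [card_insert_of_notMem hcon.1] at this
      omega
    have hIa : I.card ≤ a := hI.2.card_le_indepNum.trans ha
    calc A.card ≤ _ := card_le_card hsub
      _ ≤ I.card + I.card * N := (card_union_le _ _).trans <| by
          gcongr
          refine card_biUnion_le_card_mul _ _ _ fun i hi => hN G _ ?_ ha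
          convert hA.of_succ _ (hI.1 hi) using 1
          ext x; simp
      _ ≤ a + a * N := by gcongr

theorem indepNum_le_of_embedding {V W : Type} [Finite W] {G : SimpleGraph V}
    {H : SimpleGraph W} (f : G ↪g H) : G.indepNum ≤ H.indepNum := by
  classical
  have := Finite.of_injective f f.injective
  obtain ⟨I, hI⟩ := G.exists_isNIndepSet_indepNum
  rw [← hI.card_eq, ← card_map f.toEmbedding]
  apply IsIndepSet.card_le_indepNum
  rw [isIndepSet_iff, coe_map]
  rintro _ ⟨x, hx, rfl⟩ _ ⟨y, hy, rfl⟩ hxy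
  exact fun h => hI.isIndepSet hx hy (fun h => hxy (by rw [h])) (f.map_adj_iff.1 h)

theorem ramseyInv_le {t n : ℕ} {V : Type} [Fintype V] (hV : Fintype.card V = n)
    {G : SimpleGraph V} (hG : G.CliqueFree t) : ramseyInv t n ≤ G.indepNum := by
  let f := G.overFinIso hV
  have hfree : (G.overFin hV).CliqueFree t := hG.comap f.symm.toEmbedding.isContained
  have hmem : (G.overFin hV).indepNum ∈
      {a : ℕ | ∃ G : SimpleGraph (Fin n), G.CliqueFree t ∧ G.indepNum = a} := ⟨_, hfree, rfl⟩
  exact (Nat.sInf_le hmem).trans (indepNum_le_of_embedding f.symm.toEmbedding)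

theorem exists_indepNum_eq_ramseyInv {t : ℕ} (ht : 2 ≤ t) (n : ℕ) :
    ∃ G : SimpleGraph (Fin n), G.CliqueFree t ∧ G.indepNum = ramseyInv t n :=
  Nat.sInf_mem (s := {a : ℕ | ∃ G : SimpleGraph (Fin n), G.CliqueFree t ∧ G.indepNum = a})
    ⟨_, ⊥, cliqueFree_bot ht, rfl⟩

theorem tendsto_ramseyInv {t : ℕ} (ht : 2 ≤ t) : Tendsto (ramseyInv t) atTop atTop := by
  rw [tendsto_atTop]
  intro a
  obtain ⟨N, hN⟩ := exists_card_le_of_cliqueFreeOn t a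
  filter_upwards [eventually_gt_atTop N] with n hn
  obtain ⟨G, hG, hGα⟩ := exists_indepNum_eq_ramseyInv ht n
  by_contra! h
  have := hN G univ hG.cliqueFreeOn (by omega)
  simp at this
  omega

/-- Otherwise `Q(t, ·)` would stay bounded along a geometric progression of ratio `r`. The
strictness matters because `rtNumber` demands independence number strictly below the threshold. -/
theorem frequently_ramseyInv_lt {t r : ℕ} (ht : 2 ≤ t) (hr : 2 ≤ r) :
    ∃ᶠ m in atTop, ramseyInv t m < ramseyInv t (r * m) := by
  intro h
  simp only [not_lt, eventually_atTop] at h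
  obtain ⟨N, hN⟩ := h
  have key : ∀ k : ℕ, ramseyInv t (r ^ k * (N + 1)) ≤ ramseyInv t (N + 1) := by
    intro k
    induction k with
    | zero => simp
    | succ k ih =>
      refine le_trans ?_ ih
      rw [pow_succ', mul_assoc]
      exact hN _ (by nlinarith [Nat.one_le_pow k r (by omega)])
  have hT : Tendsto (fun k : ℕ => r ^ k * (N + 1)) atTop atTop :=
    (tendsto_pow_atTop_atTop_of_one_lt (by omega)).atTop_mul_const' (by omega)
  obtain ⟨k, hk⟩ := ((tendsto_ramseyInv ht).comp hT |>.eventually_gt_atTop _).exists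
  exact (key k).not_gt hk

/-! ### Edge counts and bounds for Ramsey–Turán numbers -/

theorem two_mul_ncard_edgeSet {V : Type} [Fintype V] [DecidableEq V] (G : SimpleGraph V)
    [DecidableRel G.Adj] :
    2 * G.edgeSet.ncard = (univ.filter fun p : V × V => G.Adj p.1 p.2).card := by
  rw [← coe_edgeFinset, Set.ncard_coe_finset, ← sum_degrees_eq_twice_card_edges,
    card_filter, Fintype.sum_prod_type]
  refine sum_congr rfl fun v _ => ?_
  rw [← card_filter, ← card_neighborFinset_eq_degree, neighborFinset_eq_filter]

theorem ncard_edgeSet_le {n : ℕ} (G : SimpleGraph (Fin n)) : G.edgeSet.ncard ≤ n ^ 2 := by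
  classical
  have h1 := two_mul_ncard_edgeSet G
  have h2 := card_le_univ (univ.filter fun p : Fin n × Fin n => G.Adj p.1 p.2)
  simp only [Fintype.card_prod, Fintype.card_fin] at h2
  nlinarith

theorem bddAbove_rtNumber {W : Type} (n : ℕ) (H : SimpleGraph W) (x : ℝ) :
    BddAbove {m : ℕ | ∃ G : SimpleGraph (Fin n),
      H.Free G ∧ (G.indepNum : ℝ) < x ∧ G.edgeSet.ncard = m} := by
  refine ⟨n ^ 2, ?_⟩
  rintro _ ⟨G, -, -, rfl⟩
  exact ncard_edgeSet_le G

theorem rtNumber_le {W : Type} {n : ℕ} {H : SimpleGraph W} {x c : ℝ} (hc : 0 ≤ c)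
    (h : ∀ G : SimpleGraph (Fin n), H.Free G → (G.indepNum : ℝ) < x → (G.edgeSet.ncard : ℝ) ≤ c) :
    (rtNumber n H x : ℝ) ≤ c := by
  obtain hne | hne := Set.eq_empty_or_nonempty {m : ℕ | ∃ G : SimpleGraph (Fin n),
      H.Free G ∧ (G.indepNum : ℝ) < x ∧ G.edgeSet.ncard = m}
  · rw [rtNumber, hne]; simpa
  · obtain ⟨G, h1, h2, h3⟩ := Nat.sSup_mem hne (bddAbove_rtNumber n H x)
    rw [rtNumber, ← h3]
    exact h G h1 h2

theorem le_rtNumber {W V : Type} [Fintype V] {n : ℕ} (hV : Fintype.card V = n)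
    {H : SimpleGraph W} {x : ℝ} {G : SimpleGraph V} (hG : H.Free G) (hx : (G.indepNum : ℝ) < x) :
    G.edgeSet.ncard ≤ rtNumber n H x := by
  let f := G.overFinIso hV
  refine le_csSup (bddAbove_rtNumber n H x) ⟨G.overFin hV, ?_, ?_, ?_⟩
  · exact fun h => hG (h.trans f.symm.toEmbedding.isContained)
  · refine lt_of_le_of_lt ?_ hx
    exact_mod_cast indepNum_le_of_embedding f.symm.toEmbedding
  · exact (Nat.card_congr f.mapEdgeSet).symm

theorem rtNumber_div_le_one {W : Type} (n : ℕ) (H : SimpleGraph W) (x : ℝ) :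
    (rtNumber n H x : ℝ) / (n : ℝ) ^ 2 ≤ 1 := by
  refine div_le_one_of_le₀ (rtNumber_le (by positivity) fun G _ _ => ?_) (by positivity)
  exact_mod_cast ncard_edgeSet_le G

theorem le_upperDensity {W : Type} {H : SimpleGraph W} {f : ℕ → ℝ} {c : ℝ}
    (h : ∃ᶠ n : ℕ in atTop, c ≤ (rtNumber n H (f n) : ℝ) / (n : ℝ) ^ 2) :
    c ≤ upperDensity H f :=
  le_limsup_of_frequently_le h ⟨1, by simpa using ⟨0, fun n _ => rtNumber_div_le_one n H (f n)⟩⟩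

theorem upperDensity_le {W : Type} {H : SimpleGraph W} {f : ℕ → ℝ} {c : ℝ}
    (h : ∀ᶠ n : ℕ in atTop, (rtNumber n H (f n) : ℝ) / (n : ℝ) ^ 2 ≤ c) :
    upperDensity H f ≤ c :=
  limsup_le_of_le ⟨0, fun a ha => by
    obtain ⟨n, hn⟩ := (eventually_map.1 ha).exists
    exact le_trans (by positivity) hn⟩ h

/-! ### Lexicographic products: joins and disjoint copies -/

/-- Lexicographic product of graphs. -/
def lexGraph {ι W : Type} (B : SimpleGraph ι) (H : SimpleGraph W) : SimpleGraph (ι × W) where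
  Adj p q := B.Adj p.1 q.1 ∨ p.1 = q.1 ∧ H.Adj p.2 q.2
  symm := ⟨fun _ _ h => h.elim (fun h => .inl h.symm) fun h => .inr ⟨h.1.symm, h.2.symm⟩⟩
  loopless := ⟨fun _ h => h.elim (fun h => h.ne rfl) fun h => h.2.ne rfl⟩

/-- A clique projects to a clique of `B`, and each fibre of the projection is a clique of `H`. -/
theorem cliqueFree_lexGraph {ι W : Type} [Fintype ι] [Finite W] {B : SimpleGraph ι}
    {H : SimpleGraph W} {t : ℕ} (hH : H.CliqueFree (t + 1)) {r : ℕ} (hB : B.CliqueFree (r + 1)) :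
    (lexGraph B H).CliqueFree (r * t + 1) := by
  classical
  intro K hK
  have hfib : ∀ i ∈ K.image Prod.fst, (K.filter fun p => p.1 = i).card ≤ t := by
    intro i _
    have hinj : Set.InjOn (Prod.snd : ι × W → W) (K.filter fun p => p.1 = i) := by
      intro p hp q hq h
      simp only [coe_filter, Set.mem_ofPred_eq] at hp hq
      exact Prod.ext (hp.2.trans hq.2.symm) h
    rw [← card_image_of_injOn hinj]
    by_contra! hlt
    obtain ⟨S, hS, hcard⟩ := exists_subset_card_eq hlt
    refine hH S ⟨?_, hcard⟩
    intro x hx y hy hxy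
    obtain ⟨p, hp, rfl⟩ := mem_image.1 (hS hx)
    obtain ⟨q, hq, rfl⟩ := mem_image.1 (hS hy)
    simp only [mem_filter] at hp hq
    have hpq := hp.2.trans hq.2.symm
    rcases hK.isClique hp.1 hq.1 (fun h => hxy (by rw [h])) with h | h
    · exact absurd hpq h.ne
    · exact h.2
  have himg : (K.image Prod.fst).card ≤ r := by
    by_contra! hlt
    obtain ⟨S, hS, hcard⟩ := exists_subset_card_eq hlt
    refine hB S ⟨?_, hcard⟩
    intro x hx y hy hxy
    obtain ⟨p, hp, rfl⟩ := mem_image.1 (hS hx)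
    obtain ⟨q, hq, rfl⟩ := mem_image.1 (hS hy)
    rcases hK.isClique hp hq (fun h => hxy (by rw [h])) with h | h
    · exact h
    · exact absurd h.1 hxy
  have h1 := card_le_mul_card_image K t hfib
  have h2 := hK.card_eq
  have h3 := Nat.mul_le_mul_left t himg
  rw [mul_comm r t] at h2
  omega

theorem indepNum_lexGraph_top_le {ι W : Type} [Fintype ι] [Finite W] (H : SimpleGraph W) :
    (lexGraph (⊤ : SimpleGraph ι) H).indepNum ≤ H.indepNum := by
  classical
  obtain ⟨I, hI⟩ := (lexGraph (⊤ : SimpleGraph ι) H).exists_isNIndepSet_indepNum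
  have hfst : ∀ p ∈ I, ∀ q ∈ I, p.1 = q.1 := by
    intro p hp q hq
    by_contra h
    exact hI.isIndepSet hp hq (fun h' => h (by rw [h'])) (.inl h)
  have hinj : Set.InjOn (Prod.snd : ι × W → W) I := fun p hp q hq h =>
    Prod.ext (hfst p hp q hq) h
  rw [← hI.card_eq, ← card_image_of_injOn hinj]
  apply IsIndepSet.card_le_indepNum
  rw [isIndepSet_iff]
  intro x hx y hy hxy hadj
  obtain ⟨p, hp, rfl⟩ := mem_image.1 (mem_coe.1 hx)
  obtain ⟨q, hq, rfl⟩ := mem_image.1 (mem_coe.1 hy)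
  exact hI.isIndepSet hp hq (fun h => hxy (by rw [h])) (.inr ⟨hfst p hp q hq, hadj⟩)

theorem indepNum_lexGraph_bot_le {ι W : Type} [Fintype ι] [Finite W] (H : SimpleGraph W) :
    (lexGraph (⊥ : SimpleGraph ι) H).indepNum ≤ Fintype.card ι * H.indepNum := by
  classical
  obtain ⟨I, hI⟩ := (lexGraph (⊥ : SimpleGraph ι) H).exists_isNIndepSet_indepNum
  rw [← hI.card_eq, mul_comm]
  refine card_le_mul_card_image_of_maps_to (f := Prod.fst) (t := univ) (fun _ _ => mem_univ _) _ ?_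
  intro i _
  have hinj : Set.InjOn (Prod.snd : ι × W → W) (I.filter fun p => p.1 = i) := by
    intro p hp q hq h
    simp only [coe_filter, Set.mem_ofPred_eq] at hp hq
    exact Prod.ext (hp.2.trans hq.2.symm) h
  rw [← card_image_of_injOn hinj]
  apply IsIndepSet.card_le_indepNum
  rw [isIndepSet_iff]
  intro x hx y hy hxy hadj
  obtain ⟨p, hp, rfl⟩ := mem_image.1 (mem_coe.1 hx)
  obtain ⟨q, hq, rfl⟩ := mem_image.1 (mem_coe.1 hy)
  simp only [mem_filter] at hp hq
  exact hI.isIndepSet hp.1 hq.1 (fun h => hxy (by rw [h])) (.inr ⟨hp.2.trans hq.2.symm, hadj⟩)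

theorem card_edgeSet_lexGraph_top (r m : ℕ) (H : SimpleGraph (Fin m)) :
    r * (r - 1) * m ^ 2 ≤ 2 * (lexGraph (⊤ : SimpleGraph (Fin r)) H).edgeSet.ncard := by
  classical
  rw [two_mul_ncard_edgeSet]
  have h : ((univ : Finset (Fin r)).offDiag ×ˢ (univ : Finset (Fin m × Fin m))).card
      = r * (r - 1) * m ^ 2 := by
    rw [card_product, offDiag_card]
    simp [Nat.mul_sub, sq]
  rw [← h]
  refine card_le_card_of_injOn (fun p => ((p.1.1, p.2.1), (p.1.2, p.2.2))) ?_ ?_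
  · rintro ⟨⟨i, j⟩, x, y⟩ hp
    simp at hp ⊢
    exact .inl hp
  · rintro ⟨⟨i, j⟩, x, y⟩ _ ⟨⟨i', j'⟩, x', y'⟩ _ h
    simp at h ⊢
    tauto

/-- Joining `r` optimal `K_{t+1}`-free graphs completely gives a lower bound. -/
theorem le_upperDensity_ramseyInv_succ {s t r : ℕ} (ht : 1 ≤ t) (hr : 1 ≤ r) (hs : r * t < s) :
    (1 - 1 / (r : ℝ)) / 2 ≤ upperDensity (completeGraph (Fin s))
      (fun n => (ramseyInv (t + 1) n : ℝ)) := by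
  apply le_upperDensity
  -- For `r = 1` the bound is `0`; the growth lemma needs `r ≥ 2`.
  obtain rfl | hr := hr.eq_or_lt
  · exact Eventually.frequently (Eventually.of_forall fun n => by simp; positivity)
  have hT : Tendsto (fun m : ℕ => r * m) atTop atTop :=
    tendsto_id.const_mul_atTop' (by omega)
  refine hT.frequently (((frequently_ramseyInv_lt (t := t + 1) (by omega) hr).and_eventually
    (eventually_gt_atTop 0)).mono ?_)
  rintro m ⟨hlt, hm⟩
  obtain ⟨H, hH, hα⟩ := exists_indepNum_eq_ramseyInv (t := t + 1) (by omega) m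
  let G := lexGraph (⊤ : SimpleGraph (Fin r)) H
  have hfree : (completeGraph (Fin s)).Free G := by
    have hB : (⊤ : SimpleGraph (Fin r)).CliqueFree (r + 1) := cliqueFree_of_card_lt (by simp)
    have := (cliqueFree_lexGraph hH hB).mono (Nat.succ_le_of_lt hs)
    rwa [← Fintype.card_fin s, cliqueFree_iff_top_free] at this
  have hle := le_rtNumber (n := r * m) (x := (ramseyInv (t + 1) (r * m) : ℝ)) (by simp) hfree (by
    have := (indepNum_lexGraph_top_le (ι := Fin r) H).trans_lt (hα ▸ hlt)
    exact_mod_cast this)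
  have hed := (card_edgeSet_lexGraph_top r m H).trans (Nat.mul_le_mul_left 2 hle)
  have hed' : (r : ℝ) * (r - 1) * m ^ 2 ≤ 2 *
      (rtNumber (r * m) (completeGraph (Fin s)) (ramseyInv (t + 1) (r * m) : ℝ) : ℝ) := by
    have : ((r - 1 : ℕ) : ℝ) = r - 1 := by push_cast [Nat.cast_sub hr.le]; ring
    rw [← this]; exact_mod_cast hed
  have hm' : (0 : ℝ) < m := by exact_mod_cast hm
  have hr' : (0 : ℝ) < r := by exact_mod_cast (by omega : 0 < r)
  rw [le_div_iff₀ (by positivity)]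
  push_cast
  have : (1 - 1 / (r : ℝ)) / 2 * (r * m) ^ 2 = r * (r - 1) * m ^ 2 / 2 := by field_simp
  rw [this]
  linarith

/-- Disjoint copies of a `K_t`-free induced subgraph bound the inverse Ramsey function. -/
theorem ramseyInv_mul_card_le {t n : ℕ} (G : SimpleGraph (Fin n)) (U : Finset (Fin n))
    (hU : G.CliqueFreeOn U t) : ramseyInv t n * U.card ≤ 2 * n * G.indepNum := by
  classical
  obtain hm | hm := U.card.eq_zero_or_pos
  · simp [hm]
  have hle : U.card ≤ n := by simpa using U.card_le_univ
  rcases t with _ | t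
  · exact absurd (by simp [isNClique_iff]) (hU (t := ∅) (by simp))
  have hfree : (G.induce (U : Set (Fin n))).CliqueFree (t + 1) := by
    intro K hK
    refine hU (t := K.map (Function.Embedding.subtype _)) ?_ ?_
    · intro x hx
      simp only [coe_map, Set.mem_image] at hx
      obtain ⟨y, -, rfl⟩ := hx
      exact y.2
    · exact (hK.map (f := Function.Embedding.subtype _)).mono (map_comap_le _ _)
  have hlex := cliqueFree_lexGraph (ι := Fin (n / U.card + 1)) hfree (cliqueFree_bot le_rfl)
  rw [one_mul] at hlex
  -- `⌊n/|U|⌋ + 1` copies of `U` have at least `n` vertices; any `n` of them carry a `K_t`-free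
  -- graph.
  obtain ⟨f⟩ : Nonempty (Fin n ↪ Fin (n / U.card + 1) × (U : Set (Fin n))) := by
    apply Function.Embedding.nonempty_of_card_le
    simpa [add_mul] using (Nat.lt_div_mul_add hm).le
  have h1 : ramseyInv (t + 1) n ≤ (n / U.card + 1) * G.indepNum :=
    calc _ ≤ _ := ramseyInv_le (Fintype.card_fin n)
            (hlex.comap (Embedding.comap f _).isContained)
      _ ≤ _ := indepNum_le_of_embedding (Embedding.comap f _)
      _ ≤ _ := indepNum_lexGraph_bot_le _
      _ ≤ (n / U.card + 1) * G.indepNum := by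
        rw [Fintype.card_fin]
        gcongr
        exact indepNum_le_of_embedding (Embedding.induce _)
  calc _ ≤ (n / U.card + 1) * G.indepNum * U.card := Nat.mul_le_mul_right _ h1
    _ = (n / U.card * U.card + U.card) * G.indepNum := by ring
    _ ≤ (n + n) * G.indepNum := by gcongr; exact Nat.div_mul_le_self _ _
    _ = _ := by ring

/-! ### Moon–Moser inequality and supersaturation -/

section Cliques

variable {V : Type} [Fintype V] (G : SimpleGraph V)

open Classical in
/-- Ordered `m`-cliques of a graph. -/
noncomputable def cliqueTuples (m : ℕ) : Finset (Fin m → V) :=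
  univ.filter fun x => ∀ i j, i ≠ j → G.Adj (x i) (x j)

open Classical in
/-- The number of common neighbours of the entries of a tuple. -/
noncomputable def commonNeighbors {m : ℕ} (y : Fin m → V) : ℕ :=
  (univ.filter fun v => ∀ i, G.Adj v (y i)).card

variable {G}

theorem mem_cliqueTuples {m : ℕ} {x : Fin m → V} :
    x ∈ cliqueTuples G m ↔ ∀ i j, i ≠ j → G.Adj (x i) (x j) := by
  simp [cliqueTuples]

theorem insertNth_mem_cliqueTuples {m : ℕ} (p : Fin (m + 1)) (v : V) (y : Fin m → V) :
    p.insertNth (α := fun _ => V) v y ∈ cliqueTuples G (m + 1) ↔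
      y ∈ cliqueTuples G m ∧ ∀ i, G.Adj v (y i) := by
  simp only [mem_cliqueTuples, Fin.forall_iff_succAbove p, Fin.insertNth_apply_same,
    Fin.insertNth_apply_succAbove, ne_eq, not_true_eq_false, false_implies, true_and,
    Fin.ne_succAbove p, Fin.succAbove_ne p, not_false_eq_true, true_implies,
    (Fin.succAbove_right_injective (p := p)).eq_iff, forall_and]
  constructor
  · exact fun h => ⟨h.2.2, h.2.1⟩
  · exact fun h => ⟨fun i => (h.2 i).symm, h.2, h.1⟩

/-- Group the cliques by what remains after deleting coordinate `p`: the deleted entry ranges over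
the common neighbours. -/
theorem sum_cliqueTuples_succ {m : ℕ} (p : Fin (m + 1)) (F : (Fin m → V) → ℕ) :
    ∑ x ∈ cliqueTuples G (m + 1), F (p.removeNth x) =
      ∑ y ∈ cliqueTuples G m, commonNeighbors G y * F y := by
  classical
  calc ∑ x ∈ cliqueTuples G (m + 1), F (p.removeNth x)
      = ∑ x : Fin (m + 1) → V, if x ∈ cliqueTuples G (m + 1) then F (p.removeNth x) else 0 := by
        simp
    _ = ∑ z : V × (Fin m → V), if p.insertNth (α := fun _ => V) z.1 z.2 ∈ cliqueTuples G (m + 1)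
          then F z.2 else 0 := by
        rw [← (Fin.insertNthEquiv (fun _ => V) p).sum_comp]
        refine sum_congr rfl fun z _ => ?_
        simp [Fin.insertNthEquiv]
    _ = ∑ y : Fin m → V, ∑ v : V, if y ∈ cliqueTuples G m ∧ ∀ i, G.Adj v (y i)
          then F y else 0 := by
        simp only [insertNth_mem_cliqueTuples, Fintype.sum_prod_type_right]
    _ = ∑ y : Fin m → V, if y ∈ cliqueTuples G m then commonNeighbors G y * F y else 0 := by
        refine sum_congr rfl fun y _ => ?_
        split_ifs with h
        · simp [h, commonNeighbors, ← sum_filter]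
        · simp [h]
    _ = _ := by simp

theorem card_cliqueTuples_succ (m : ℕ) :
    (cliqueTuples G (m + 1)).card = ∑ y ∈ cliqueTuples G m, commonNeighbors G y := by
  simpa using sum_cliqueTuples_succ (G := G) (m := m) 0 fun _ => 1

/-- A vertex adjacent to every entry of `x` is counted `m + 1` times on the left; one missing some
entry can only be counted when that entry is removed. -/
theorem sum_commonNeighbors_removeNth_le {m : ℕ} (x : Fin (m + 1) → V) :
    ∑ p : Fin (m + 1), commonNeighbors G (p.removeNth x) ≤ Fintype.card V + m * commonNeighbors G x := by
  classical
  simp only [commonNeighbors, card_filter]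
  rw [sum_comm, mul_sum, Fintype.card_eq_sum_ones, ← sum_add_distrib]
  refine sum_le_sum fun v _ => ?_
  split_ifs with h
  · refine (sum_le_card_nsmul univ _ 1 fun p _ => by split_ifs <;> simp).trans ?_
    simp [add_comm]
  · push Not at h
    obtain ⟨i, hi⟩ := h
    rw [sum_eq_single_of_mem i (mem_univ _)]
    · split_ifs <;> simp
    · intro p _ hp
      rw [if_neg]
      intro hall
      obtain ⟨j, rfl⟩ := Fin.exists_succAbove_eq hp.symm
      exact hi (hall j)

/-- The Moon–Moser inequality, for ordered cliques. -/
theorem moon_moser (m : ℕ) :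
    (m + 1) * (cliqueTuples G (m + 1)).card ^ 2 ≤ (cliqueTuples G m).card *
      (Fintype.card V * (cliqueTuples G (m + 1)).card + m * (cliqueTuples G (m + 2)).card) := by
  have h1 : (m + 1) * ∑ y ∈ cliqueTuples G m, commonNeighbors G y ^ 2 ≤
      Fintype.card V * (cliqueTuples G (m + 1)).card + m * (cliqueTuples G (m + 2)).card :=
    calc (m + 1) * ∑ y ∈ cliqueTuples G m, commonNeighbors G y ^ 2
        = ∑ p : Fin (m + 1), ∑ x ∈ cliqueTuples G (m + 1), commonNeighbors G (p.removeNth x) := by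
          simp [sum_cliqueTuples_succ, sq]
      _ ≤ ∑ x ∈ cliqueTuples G (m + 1), (Fintype.card V + m * commonNeighbors G x) := by
          rw [sum_comm]
          exact sum_le_sum fun x _ => sum_commonNeighbors_removeNth_le x
      _ = _ := by
          rw [card_cliqueTuples_succ (m + 1), sum_add_distrib, mul_sum]
          simp [mul_comm]
  -- Cauchy–Schwarz.
  have h2 : (cliqueTuples G (m + 1)).card ^ 2 ≤
      (cliqueTuples G m).card * ∑ y ∈ cliqueTuples G m, commonNeighbors G y ^ 2 := by
    rw [card_cliqueTuples_succ]
    exact sq_sum_le_card_mul_sum_sq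
  calc _ ≤ (m + 1) * ((cliqueTuples G m).card * ∑ y ∈ cliqueTuples G m,
        commonNeighbors G y ^ 2) := by gcongr
    _ = (cliqueTuples G m).card * ((m + 1) * ∑ y ∈ cliqueTuples G m,
        commonNeighbors G y ^ 2) := by ring
    _ ≤ _ := by gcongr

theorem card_cliqueTuples_one : (cliqueTuples G 1).card = Fintype.card V := by
  rw [card_cliqueTuples_succ]
  have : cliqueTuples G 0 = univ := by ext; simp [cliqueTuples]
  simp [this, commonNeighbors]

theorem card_cliqueTuples_two : (cliqueTuples G 2).card = 2 * G.edgeSet.ncard := by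
  classical
  rw [two_mul_ncard_edgeSet]
  refine card_bij (fun x _ => (x 0, x 1)) ?_ ?_ ?_
  · intro x hx
    simpa using mem_cliqueTuples.1 hx 0 1 (by simp)
  · intro x _ y _ h
    simp only [Prod.mk.injEq] at h
    ext i
    fin_cases i
    exacts [h.1, h.2]
  · rintro ⟨a, b⟩ h
    simp only [mem_filter, mem_univ, true_and] at h
    exact ⟨![a, b], mem_cliqueTuples.2 (by simp [Fin.forall_fin_two, h, h.symm]), rfl⟩

/-- Supersaturation: a graph whose edge density exceeds the Turán density of `K_{r+1}` by `δ` has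
many ordered `(r+1)`-cliques. -/
theorem pow_mul_le_card_cliqueTuples {r : ℕ} (hr : 1 ≤ r) {δ : ℝ} (hδ : 0 < δ)
    (hG : ((1 - 1 / (r : ℝ)) + δ) * (Fintype.card V : ℝ) ^ 2 ≤ 2 * (G.edgeSet.ncard : ℝ)) :
    δ ^ r * (Fintype.card V : ℝ) ^ (r + 1) ≤ ((cliqueTuples G (r + 1)).card : ℝ) := by
  set n : ℝ := (Fintype.card V : ℝ) with hn
  obtain h0 | hpos := Nat.eq_zero_or_pos (Fintype.card V)
  · simp [hn, h0]
  have hn0 : 0 < n := by rw [hn]; exact_mod_cast hpos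
  set k : ℕ → ℝ := fun m => (cliqueTuples G m).card with hk
  have hr0 : (0 : ℝ) < r := by exact_mod_cast hr
  -- The induction carries a lower bound on the ratio of consecutive clique counts; at `m + 1 = r`
  -- it becomes `δ * n`. Positivity permits cancelling in Moon–Moser.
  have key : ∀ m : ℕ, m + 1 ≤ r → (0 < k (m + 1) ∧ δ ^ m * n ^ (m + 1) ≤ k (m + 1)) ∧
      (1 - (m + 1) / r + δ) * n * k (m + 1) ≤ k (m + 2) := by
    intro m
    induction m with
    | zero =>
      intro _
      have h1 : k 1 = n := by simp [hk, hn, card_cliqueTuples_one]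
      have h2 : k 2 = 2 * (G.edgeSet.ncard : ℝ) := by simp [hk, card_cliqueTuples_two]
      simp only [zero_add, h1, h2]
      refine ⟨⟨hn0, by simp⟩, ?_⟩
      refine le_trans (le_of_eq ?_) hG
      push_cast; ring
    | succ m ih =>
      intro hm
      obtain ⟨⟨hp, hle⟩, hstep⟩ := ih (by omega)
      have hmr : ((m + 1 : ℕ) + 1 : ℝ) ≤ r := by exact_mod_cast hm
      push_cast at hmr
      have hfrac : ((m : ℝ) + 1) / r ≤ 1 := by rw [div_le_one hr0]; linarith
      have hδ' : δ * n * k (m + 1) ≤ k (m + 2) := by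
        refine le_trans ?_ hstep
        gcongr
        linarith
      have hp2 : 0 < k (m + 2) := lt_of_lt_of_le (by positivity) hδ'
      refine ⟨⟨hp2, ?_⟩, ?_⟩
      · refine le_trans ?_ hδ'
        calc δ ^ (m + 1) * n ^ (m + 1 + 1) = δ * n * (δ ^ m * n ^ (m + 1)) := by ring
          _ ≤ _ := by gcongr
      · have hMM : ((m : ℝ) + 2) * k (m + 2) ^ 2 ≤
            k (m + 1) * (n * k (m + 2) + (m + 1) * k (m + 3)) := by
          have := moon_moser (G := G) (m + 1)
          have h' : (((m + 1 : ℕ) + 1 : ℕ) : ℝ) * k (m + 2) ^ 2 ≤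
            k (m + 1) * (n * k (m + 2) + ((m + 1 : ℕ) : ℝ) * k (m + 3)) := by
            simp only [hk, hn]; exact_mod_cast this
          push_cast at h'
          linarith
        have h3 : ((m : ℝ) + 2) * ((1 - (m + 1) / r + δ) * n) * k (m + 2) ≤
            n * k (m + 2) + (m + 1) * k (m + 3) := by
          refine le_of_mul_le_mul_left (le_trans ?_ hMM) hp
          calc k (m + 1) * (((m : ℝ) + 2) * ((1 - (m + 1) / r + δ) * n) * k (m + 2))
              = ((m : ℝ) + 2) * k (m + 2) * ((1 - (m + 1) / r + δ) * n * k (m + 1)) := by ring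
            _ ≤ ((m : ℝ) + 2) * k (m + 2) * k (m + 2) := by gcongr
            _ = _ := by ring
        have hm1 : (0 : ℝ) < m + 1 := by positivity
        refine le_of_mul_le_mul_left ?_ hm1
        have h4 : (0 : ℝ) ≤ δ * n * k (m + 2) := by positivity
        have h5 : ((m : ℝ) + 1) * ((1 - ((m + 1 : ℕ) + 1) / r + δ) * n * k (m + 1 + 1)) =
            ((m : ℝ) + 2) * ((1 - (m + 1) / r + δ) * n) * k (m + 2) - n * k (m + 2)
              - δ * n * k (m + 2) := by
          push_cast; field_simp; ring
        rw [h5]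
        have : k (m + 1 + 2) = k (m + 3) := rfl
        rw [this]
        linarith
  obtain ⟨m, rfl⟩ : ∃ m, r = m + 1 := ⟨r - 1, by omega⟩
  obtain ⟨⟨hp, hle⟩, hstep⟩ := key m le_rfl
  push_cast at hstep hr0
  rw [div_self hr0.ne'] at hstep
  calc δ ^ (m + 1) * n ^ (m + 1 + 1) = δ * n * (δ ^ m * n ^ (m + 1)) := by ring
    _ ≤ δ * n * k (m + 1) := by gcongr
    _ ≤ _ := by linarith

end Cliques

/-! ### Dependent random choice -/

theorem card_filter_forall_pi {W : Type} [Fintype W] (p : W → Prop) [DecidablePred p] (l : ℕ) :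
    (univ.filter fun w : Fin l → W => ∀ i, p (w i)).card = (univ.filter p).card ^ l := by
  have : (univ.filter fun w : Fin l → W => ∀ i, p (w i)) =
      Fintype.piFinset fun _ => univ.filter p := by
    ext w; simp [Fintype.mem_piFinset]
  rw [this, Fintype.card_piFinset]
  simp

open Classical in
/-- Dependent random choice. -/
theorem dependent_random_choice {V W : Type} [Fintype V] [Nonempty V] [Fintype W] [Nonempty W]
    (R : V → W → Prop) (t l : ℕ) {γ μ : ℝ} (hγ : 0 < γ) (hμ : 0 ≤ μ)
    (hR : γ * Fintype.card V * Fintype.card W ≤ ∑ v, ((univ.filter (R v)).card : ℝ))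
    (h : (Fintype.card V : ℝ) ^ t * μ ^ (l + 1) ≤ γ ^ (l + 1) / 2) :
    ∃ U : Finset V, γ ^ (l + 1) / 2 * Fintype.card V ≤ U.card ∧
      ∀ S ⊆ U, S.card = t →
        μ * Fintype.card W ≤ ((univ.filter fun w => ∀ v ∈ S, R v w).card : ℝ) := by
  set n : ℝ := (Fintype.card V : ℝ) with hn
  set N : ℝ := (Fintype.card W : ℝ) with hN
  have hn0 : 0 < n := by rw [hn]; exact_mod_cast Fintype.card_pos
  have hN0 : 0 < N := by rw [hN]; exact_mod_cast Fintype.card_pos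
  -- `U w` is the common neighbourhood of a sample of `l + 1` points, `B` the family of bad
  -- `t`-sets, and `b w` the number of them inside `U w`.
  let U : (Fin (l + 1) → W) → Finset V := fun w => univ.filter fun v => ∀ i, R v (w i)
  let B : Finset (Finset V) := (univ.powersetCard t).filter fun S =>
    ((univ.filter fun w => ∀ v ∈ S, R v w).card : ℝ) < μ * N
  let b : (Fin (l + 1) → W) → ℕ := fun w => (B.filter fun S => S ⊆ U w).card
  have hU : γ ^ (l + 1) * n * N ^ (l + 1) ≤ ∑ w, ((U w).card : ℝ) := by
    have h1 : ∑ w, ((U w).card : ℝ) = ∑ v, ((univ.filter (R v)).card : ℝ) ^ (l + 1) := by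
      simp only [U, card_filter, Nat.cast_sum]
      rw [sum_comm]
      refine sum_congr rfl fun v _ => ?_
      rw [← Nat.cast_sum, ← card_filter, card_filter_forall_pi (R v), card_filter]
      push_cast; rfl
    rw [h1]
    have h2 := pow_sum_div_card_le_sum_pow (s := univ)
      (f := fun v => ((univ.filter (R v)).card : ℝ)) (fun _ _ => by positivity) l
    refine le_trans ?_ h2
    rw [card_univ, ← hn, le_div_iff₀ (by positivity)]
    calc γ ^ (l + 1) * n * N ^ (l + 1) * n ^ l = (γ * n * N) ^ (l + 1) := by ring
      _ ≤ _ := by gcongr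
  have hB : ∑ w, (b w : ℝ) ≤ n ^ t * (μ ^ (l + 1) * N ^ (l + 1)) := by
    have h1 : ∑ w, (b w : ℝ) =
        ∑ S ∈ B, ((univ.filter fun w => ∀ v ∈ S, R v w).card : ℝ) ^ (l + 1) := by
      simp only [b, card_filter, Nat.cast_sum]
      rw [sum_comm]
      refine sum_congr rfl fun S _ => ?_
      rw [← Nat.cast_sum, ← card_filter, ← Nat.cast_sum, ← card_filter, ← Nat.cast_pow,
        ← card_filter_forall_pi (fun w => ∀ v ∈ S, R v w)]
      congr 2
      ext w
      simp only [U, subset_iff, mem_filter, mem_univ, true_and]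
      exact ⟨fun h i v hv => h hv i, fun h v hv i => h i v hv⟩
    rw [h1]
    calc _ ≤ ∑ S ∈ B, (μ * N) ^ (l + 1) := by
          refine sum_le_sum fun S hS => ?_
          have := (mem_filter.1 hS).2.le
          gcongr
      _ = B.card * (μ ^ (l + 1) * N ^ (l + 1)) := by rw [sum_const, nsmul_eq_mul, mul_pow]
      _ ≤ _ := by
          gcongr
          have h3 : B.card ≤ Fintype.card V ^ t :=
            (card_filter_le _ _).trans (by
              rw [card_powersetCard]
              exact Nat.choose_le_pow _ _)
          rw [hn]; exact_mod_cast h3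
  -- The weight `n` on bad sets makes deletion unnecessary: as `|U w| ≤ n`, a positive value of `|U
  -- w| - n * b w` forces `b w = 0`.
  have hsum : ∑ _w : Fin (l + 1) → W, γ ^ (l + 1) / 2 * n ≤
      ∑ w, (((U w).card : ℝ) - n * b w) := by
    rw [sum_sub_distrib, ← mul_sum (f := fun w => (b w : ℝ)), sum_const, card_univ, Fintype.card_fun, Fintype.card_fin,
      nsmul_eq_mul]
    push_cast
    rw [← hN]
    have h4 : n * ∑ w, (b w : ℝ) ≤ n * (γ ^ (l + 1) / 2 * N ^ (l + 1)) := by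
      refine mul_le_mul_of_nonneg_left (hB.trans ?_) hn0.le
      rw [← mul_assoc]
      gcongr
    linarith
  obtain ⟨w, -, hw⟩ := exists_le_of_sum_le univ_nonempty hsum
  have hpos : 0 < γ ^ (l + 1) / 2 * n := by positivity
  have hUn : ((U w).card : ℝ) ≤ n := by rw [hn]; exact_mod_cast card_le_univ _
  have hb : b w = 0 := by
    by_contra hb
    have : (1 : ℝ) ≤ b w := by exact_mod_cast Nat.one_le_iff_ne_zero.2 hb
    nlinarith
  refine ⟨U w, by simpa [hb] using hw, fun S hS hcard => ?_⟩
  by_contra! hlt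
  have hmem : S ∈ B.filter fun S => S ⊆ U w :=
    mem_filter.2 ⟨mem_filter.2 ⟨mem_powersetCard_univ.2 hcard, hlt⟩, hS⟩
  rw [card_eq_zero.1 hb] at hmem
  exact notMem_empty _ hmem

/-! ### Asymptotics of `weakScale` -/

theorem tendsto_logb_natCast : Tendsto (fun n : ℕ => Real.logb 2 (n : ℝ)) atTop atTop :=
  (Real.tendsto_logb_atTop one_lt_two).comp tendsto_natCast_atTop_atTop

theorem eventually_le_logb_rpow {ε : ℝ} (hε : 0 < ε) (c : ℝ) :
    ∀ᶠ n : ℕ in atTop, 1 ≤ Real.logb 2 (n : ℝ) ∧ c ≤ Real.logb 2 (n : ℝ) ^ ε :=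
  (tendsto_logb_natCast.eventually_ge_atTop 1).and
    (((tendsto_rpow_atTop hε).comp tendsto_logb_natCast).eventually_ge_atTop c)

theorem weakScale_pos (ε : ℝ) (n : ℕ) : 0 < weakScale ε n := Real.rpow_pos_of_pos two_pos _

theorem tendsto_weakScale {ε : ℝ} (hε : ε < 1) : Tendsto (weakScale ε) atTop (𝓝 0) := by
  have h := (tendsto_rpow_atTop (sub_pos.2 hε)).comp tendsto_logb_natCast
  exact (tendsto_rpow_atBot_of_base_gt_one 2 one_lt_two).comp (tendsto_neg_atTop_atBot.comp h)

theorem weakScale_le_one (ε : ℝ) (n : ℕ) : weakScale ε n ≤ 1 := by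
  apply Real.rpow_le_one_of_one_le_of_nonpos one_le_two
  rw [neg_nonpos]
  apply Real.rpow_nonneg
  obtain rfl | hn := n.eq_zero_or_pos
  · simp
  · exact Real.logb_nonneg one_lt_two (by exact_mod_cast hn)

theorem weakScale_mono {ε ε' : ℝ} (h : ε' ≤ ε) {n : ℕ} (hn : 1 ≤ Real.logb 2 (n : ℝ)) :
    weakScale ε' n ≤ weakScale ε n := by
  apply Real.rpow_le_rpow_of_exponent_le one_le_two
  rw [neg_le_neg_iff]
  exact Real.rpow_le_rpow_of_exponent_le hn (by linarith)

/-- Numerical parameters for one application of dependent random choice. -/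
theorem eventually_exists_weakScale_pow (t : ℕ) {ε : ℝ} (hε : 0 < ε) (hε1 : ε ≤ 1) :
    ∀ᶠ n : ℕ in atTop, ∃ l : ℕ,
      (n : ℝ) ^ t * weakScale (ε / 4) n ^ (l + 1) ≤ weakScale ε n ^ (l + 1) / 2 ∧
      weakScale (ε / 4) n ≤ weakScale ε n ^ (l + 1) / 2 := by
  filter_upwards [eventually_le_logb_rpow (show 0 < ε / 4 by positivity) (t + 3),
    eventually_gt_atTop 0] with n ⟨hL, hy⟩ hn
  set x := Real.logb 2 (n : ℝ) with hx
  have hx0 : 0 < x := by linarith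
  have hnx : (n : ℝ) = 2 ^ x := by
    rw [hx, Real.rpow_logb two_pos (by norm_num) (by exact_mod_cast hn)]
  set y := x ^ (ε / 4) with hy'
  set z := x ^ (1 - ε / 4) with hz
  have ht0 : (0 : ℝ) ≤ t := by positivity
  have hy0 : 0 < y := by linarith
  have hz0 : 0 < z := Real.rpow_pos_of_pos hx0 _
  set u := x ^ (1 - ε) with hu
  have hu1 : 1 ≤ u := Real.one_le_rpow hL (by linarith)
  have hzy : z * y = x := by
    rw [hz, hy', ← Real.rpow_add hx0]; simp
  have hzu : z = u * y ^ 3 := by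
    rw [hz, hu, hy', ← Real.rpow_natCast, ← Real.rpow_mul hx0.le, ← Real.rpow_add hx0]
    congr 1; push_cast; ring
  -- With `z = u * y ^ 3`, a sample size near `y ^ 2` meets both demands: `u * m + 1 ≤ z`, while `z
  -- * m ≥ x * y` outweighs the exponent `t * x` of `n ^ t`.
  obtain ⟨l, hl1, hl2⟩ : ∃ l : ℕ, y ^ 2 ≤ ((l + 1 : ℕ) : ℝ) ∧ ((l + 1 : ℕ) : ℝ) ≤ y ^ 2 + 1 :=
    ⟨⌊y ^ 2⌋₊, by push_cast; exact (Nat.lt_floor_add_one _).le,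
      by push_cast; linarith [Nat.floor_le (show 0 ≤ y ^ 2 by positivity)]⟩
  set m : ℝ := ((l + 1 : ℕ) : ℝ) with hm
  have e1 : weakScale (ε / 4) n = 2 ^ (-z) := rfl
  have e2 : weakScale ε n = 2 ^ (-u) := rfl
  have hpow : ∀ a : ℝ, ((2 : ℝ) ^ a) ^ (l + 1) = 2 ^ (a * m) := fun a => by
    rw [← Real.rpow_natCast, ← Real.rpow_mul two_pos.le]
  have hhalf : weakScale ε n ^ (l + 1) / 2 = 2 ^ (-(u * m) - 1) := by
    rw [e2, hpow, Real.rpow_sub two_pos, Real.rpow_one]; ring_nf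
  have hkey : u * m + 1 ≤ z := by
    have h1 : y ^ 2 + 2 ≤ y ^ 3 := by nlinarith [sq_nonneg y]
    calc u * m + 1 ≤ u * (y ^ 2 + 1) + u := by gcongr
      _ = u * (y ^ 2 + 2) := by ring
      _ ≤ z := by rw [hzu]; gcongr
  refine ⟨l, ?_, ?_⟩
  · rw [hhalf, e1, hpow, hnx, ← Real.rpow_natCast, ← Real.rpow_mul two_pos.le,
      ← Real.rpow_add two_pos]
    apply Real.rpow_le_rpow_of_exponent_le one_le_two
    have h1 : x * y ≤ z * m :=
      calc x * y = z * y ^ 2 := by rw [← hzy]; ring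
        _ ≤ _ := by gcongr
    have h2 : z ≤ x := by rw [← hzy]; nlinarith
    nlinarith
  · rw [hhalf, e1]
    apply Real.rpow_le_rpow_of_exponent_le one_le_two
    linarith

/-! ### Completely joined cliques and the upper bound -/

/-- If every large vertex set contains a `t`-set satisfying `P`, then every dense `q`-ary relation
contains a product of `q` such sets. -/
theorem eventually_exists_product (q t : ℕ) {ε : ℝ} (hε : 0 < ε) (hε1 : ε ≤ 1) :
    ∀ᶠ n : ℕ in atTop, ∀ P : Finset (Fin n) → Prop,
      (∀ U : Finset (Fin n), weakScale (ε / 4 ^ q) n * n ≤ U.card →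
        ∃ S ⊆ U, S.card = t ∧ P S) →
      ∀ R : Finset (Fin q → Fin n), weakScale ε n * (n : ℝ) ^ q ≤ R.card →
        ∃ S : Fin q → Finset (Fin n), (∀ i, (S i).card = t ∧ P (S i)) ∧
          ∀ x, (∀ i, x i ∈ S i) → x ∈ R := by
  classical
  induction q generalizing ε with
  | zero =>
    refine Eventually.of_forall fun n P _ R hR => ⟨fun i => i.elim0, fun i => i.elim0, ?_⟩
    intro x _
    have hpos : (0 : ℝ) < R.card := lt_of_lt_of_le (by have := weakScale_pos ε n; simpa) hR
    obtain ⟨y, hy⟩ := card_pos.1 (Nat.cast_pos.1 hpos)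
    rwa [Subsingleton.elim x y]
  | succ q ih =>
    filter_upwards [ih (show 0 < ε / 4 by positivity) (by linarith),
      eventually_exists_weakScale_pow t hε hε1, eventually_le_logb_rpow one_pos 0,
      eventually_gt_atTop 0] with n hn ⟨l, hl1, hl2⟩ ⟨hL, _⟩ hn0 P hP R hR
    have : Nonempty (Fin n) := ⟨⟨0, hn0⟩⟩
    have hcount : (R.card : ℝ) =
        ∑ v, ((univ.filter fun w : Fin q → Fin n => (Fin.cons v w : Fin (q + 1) → Fin n) ∈ R).card :
          ℝ) := by
      have h1 : R.card = ∑ v : Fin n, ∑ w : Fin q → Fin n,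
          if (Fin.cons v w : Fin (q + 1) → Fin n) ∈ R then 1 else 0 := by
        rw [← Fintype.sum_prod_type' (f := fun (v : Fin n) (w : Fin q → Fin n) =>
          if (Fin.cons v w : Fin (q + 1) → Fin n) ∈ R then 1 else 0)]
        refine Eq.trans ?_ ((Fin.consEquiv fun _ => Fin n).sum_comp
          fun x => if x ∈ R then 1 else 0).symm
        simp
      rw [h1]
      push_cast [card_filter]
      rfl
    -- The first coordinate is played against the other `q`. The tuples extending every vertex of a
    -- good `t`-set in `U` still have density `weakScale (ε / 4) n`, so the induction continues with
    -- `ε / 4`.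
    obtain ⟨U, hU, hS⟩ := dependent_random_choice (V := Fin n) (W := Fin q → Fin n)
      (fun v w => (Fin.cons v w : Fin (q + 1) → Fin n) ∈ R) t l (weakScale_pos ε n)
      (weakScale_pos (ε / 4) n).le (by
        refine le_trans (le_of_eq ?_) (hR.trans (hcount.le.trans (le_of_eq ?_)))
        · simp; ring
        · congr!) (by simpa using hl1)
    obtain ⟨S₀, hS₀U, hS₀t, hS₀P⟩ := hP U (by
      refine le_trans ?_ hU
      rw [Fintype.card_fin]
      gcongr
      refine (weakScale_mono ?_ hL).trans hl2
      rw [pow_succ, div_mul_eq_div_div]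
      gcongr
      exact div_le_self hε.le (one_le_pow₀ (by norm_num)))
    obtain ⟨S, hSP, hSR⟩ := hn P (by
      rwa [div_div, ← pow_succ']) _ (by simpa using hS S₀ hS₀U hS₀t)
    refine ⟨Fin.cons S₀ S, Fin.cases ⟨hS₀t, hS₀P⟩ hSP, fun x hx => ?_⟩
    have h2 := hSR (Fin.tail x) fun i => hx i.succ
    simp only [mem_filter, mem_univ, true_and] at h2
    simpa using h2 (x 0) (by simpa using hx 0)

theorem cliqueFree_of_free {V : Type} {s : ℕ} {G : SimpleGraph V}
    (h : (completeGraph (Fin s)).Free G) : G.CliqueFree s := by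
  have := cliqueFree_iff_top_free (G := G) (β := Fin s)
  rw [Fintype.card_fin] at this
  exact this.2 h

theorem eventually_weakScale_half_le {ε : ℝ} (hε : 0 < ε) (hε1 : ε ≤ 1) :
    ∀ᶠ n : ℕ in atTop, weakScale (ε / 2) n ≤ weakScale ε n / 2 := by
  filter_upwards [eventually_le_logb_rpow (half_pos hε) 2] with n ⟨hL, hy⟩
  set x := Real.logb 2 (n : ℝ) with hx
  have hx0 : 0 < x := by linarith
  have h1 : 1 ≤ x ^ (1 - ε) := Real.one_le_rpow hL (by linarith)
  have h2 : x ^ (1 - ε / 2) = x ^ (1 - ε) * x ^ (ε / 2) := by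
    rw [← Real.rpow_add hx0]; congr 1; ring
  have h3 : weakScale ε n / 2 = 2 ^ (-x ^ (1 - ε) - 1) := by
    rw [Real.rpow_sub two_pos, Real.rpow_one]; rfl
  rw [h3]
  apply Real.rpow_le_rpow_of_exponent_le one_le_two
  rw [← hx, h2]
  nlinarith

/-- Cliques which are pairwise completely joined form a clique. -/
theorem not_cliqueFree_of_product {V : Type} [Fintype V] {G : SimpleGraph V} {q t : ℕ}
    (ht : 1 ≤ t) {S : Fin q → Finset V} (hS : ∀ i, (S i).card = t ∧ G.IsClique (S i : Set V))
    (hR : ∀ x : Fin q → V, (∀ i, x i ∈ S i) → x ∈ cliqueTuples G q) :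
    ¬ G.CliqueFree (q * t) := by
  classical
  have hadj : ∀ i j, i ≠ j → ∀ a ∈ S i, ∀ c ∈ S j, G.Adj a c := by
    intro i j hij a ha c hc
    have hne : ∀ k, ∃ b, b ∈ S k := fun k => card_pos.1 (by rw [(hS k).1]; exact ht)
    choose b hb using hne
    -- Since `t ≥ 1`, no `S k` is empty, so `a` and `c` can be completed to a full transversal.
    have := mem_cliqueTuples.1 (hR (Function.update (Function.update b i a) j c) fun k => by
      simp only [Function.update_apply]
      split_ifs with h1 h2
      · exact h1 ▸ hc
      · exact h2 ▸ ha
      · exact hb k) i j hij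
    simpa [Function.update_apply, hij] using this
  have hclique : G.IsNClique (q * t) (univ.biUnion S) := by
    refine ⟨?_, ?_⟩
    · intro a ha c hc hac
      simp only [coe_biUnion, coe_univ, Set.mem_univ, Set.iUnion_true, Set.mem_iUnion,
        mem_coe] at ha hc
      obtain ⟨i, hi⟩ := ha
      obtain ⟨j, hj⟩ := hc
      by_cases hij : i = j
      · subst hij
        exact (hS i).2 hi hj hac
      · exact hadj i j hij a hi c hj
    · rw [card_biUnion]
      · simp [hS]
      · intro i _ j _ hij
        exact disjoint_left.2 fun a hi hj => (hadj i j hij a hi a hj).ne rfl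
  exact fun h => h _ hclique

/-- Otherwise `ramseyInv_mul_card_le` gives `Q(t,n) |U| ≤ 2nα(G)`, contradicting the bound on
`α(G)`; the halving in `hεη` absorbs the factor `2`. -/
theorem exists_clique_subset {t n : ℕ} {η ε : ℝ} {G : SimpleGraph (Fin n)} (hn : 0 < n)
    (hα : (G.indepNum : ℝ) < weakScale ε n * ramseyInv t n)
    (hεη : weakScale ε n ≤ weakScale η n / 2) (U : Finset (Fin n))
    (hU : weakScale η n * n ≤ U.card) : ∃ S ⊆ U, S.card = t ∧ G.IsClique (S : Set (Fin n)) := by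
  by_contra! hcon
  have hfree : G.CliqueFreeOn U t := fun S hSU hS =>
    hcon S (by exact_mod_cast hSU) hS.card_eq hS.isClique
  have h1 : (ramseyInv t n : ℝ) * U.card ≤ 2 * n * G.indepNum := by
    exact_mod_cast ramseyInv_mul_card_le G U hfree
  have hn' : (0 : ℝ) < n := by exact_mod_cast hn
  have h2 : (G.indepNum : ℝ) < weakScale η n / 2 * ramseyInv t n :=
    hα.trans_le (by gcongr)
  have h3 : (ramseyInv t n : ℝ) * (weakScale η n * n) ≤ ramseyInv t n * U.card := by gcongr
  have h4 := mul_lt_mul_of_pos_left h2 (show (0 : ℝ) < 2 * n by positivity)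
  linarith

theorem upperDensity_weakScale_le {s t r : ℕ} (ht : 1 ≤ t) (hr : 1 ≤ r) (hs : s ≤ (r + 1) * t) :
    upperDensity (completeGraph (Fin s))
      (fun n => weakScale (1 / 2 / 4 ^ (r + 1) / 2) n * (ramseyInv t n : ℝ)) ≤
        (1 - 1 / (r : ℝ)) / 2 := by
  -- The clique relation is taken at scale `1 / 2`, and each of the `r + 1` coordinates costs a
  -- factor `4`. The further halving of `η` in the statement serves `exists_clique_subset`.
  set η : ℝ := 1 / 2 / 4 ^ (r + 1) with hη
  have hη0 : 0 < η := by positivity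
  have hη1 : η ≤ 1 := by
    rw [hη]
    exact (div_le_self (by norm_num) (one_le_pow₀ (by norm_num))).trans (by norm_num)
  have hr1 : 1 / (r : ℝ) ≤ 1 := by
    rw [div_le_one (by positivity)]; exact_mod_cast hr
  refine le_of_forall_pos_le_add fun δ hδ => upperDensity_le ?_
  filter_upwards [eventually_exists_product (r + 1) t one_half_pos (by norm_num),
    (tendsto_weakScale (ε := 1 / 2) (by norm_num)).eventually_le_const
      (show 0 < (2 * δ) ^ r by positivity),
    eventually_weakScale_half_le hη0 hη1, eventually_gt_atTop 0] with n hprod hδn hεη hn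
  have hn' : (0 : ℝ) < n := by exact_mod_cast hn
  rw [div_le_iff₀ (by positivity)]
  refine rtNumber_le (mul_nonneg (by linarith) (by positivity)) fun G hfree hα => ?_
  by_contra! hE
  have hcount := pow_mul_le_card_cliqueTuples (G := G) hr (δ := 2 * δ) (by positivity) (by
    rw [Fintype.card_fin]; linarith)
  rw [Fintype.card_fin] at hcount
  obtain ⟨S, hS, hSR⟩ := hprod (fun S => G.IsClique (S : Set (Fin n)))
    (exists_clique_subset hn hα hεη) (cliqueTuples G (r + 1)) (by
      refine le_trans ?_ hcount
      gcongr)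
  exact not_cliqueFree_of_product ht hS hSR ((cliqueFree_of_free hfree).mono hs)

/-- A `K_s`-free graph is here `K_t`-free, so its independence number is at least `Q(t,n)` and no
graph is admissible. -/
theorem lowerDensity_ramseyInv_eq_zero {s t : ℕ} (hs : s ≤ t) :
    lowerDensity (completeGraph (Fin s)) (fun n => (ramseyInv t n : ℝ)) = 0 := by
  have h : ∀ n, rtNumber n (completeGraph (Fin s)) (ramseyInv t n : ℝ) = 0 := by
    intro n
    have : (rtNumber n (completeGraph (Fin s)) (ramseyInv t n : ℝ) : ℝ) ≤ 0 := by
      refine rtNumber_le le_rfl fun G hfree hα => absurd hα (not_lt.2 ?_)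
      exact_mod_cast ramseyInv_le (Fintype.card_fin n) ((cliqueFree_of_free hfree).mono hs)
    exact_mod_cast le_antisymm this (by positivity)
  simp [lowerDensity, h]

end RamseyTuran

theorem mainTheorem7 (s t : ℕ) (ht : 2 ≤ t)
    (h : RamseyTuran.HasPhaseTransition (SimpleGraph.completeGraph (Fin s))
      (fun n => (RamseyTuran.ramseyInv t n : ℝ))
      (fun n => (RamseyTuran.ramseyInv (t + 1) n : ℝ))) :
    RamseyTuran.HasWeakPhaseTransition (SimpleGraph.completeGraph (Fin s))
      (fun n => (RamseyTuran.ramseyInv t n : ℝ)) := by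
  open RamseyTuran in
  obtain hst | hst := le_or_gt s t
  · have h0 := h.2
    rw [lowerDensity_ramseyInv_eq_zero hst] at h0
    exact absurd h0 (not_lt.2 (le_upperDensity
      (Eventually.frequently (Eventually.of_forall fun n => by positivity))))
  -- Taking `s - 1` rather than `s` makes `r * t < s` strict, as the join construction requires.
  have hr : 1 ≤ (s - 1) / t := (Nat.one_le_div_iff (by omega)).2 (by omega)
  have hlow : (s - 1) / t * t < s := by
    have := Nat.div_mul_le_self (s - 1) t
    omega
  have hupp : s ≤ ((s - 1) / t + 1) * t := by
    have := Nat.lt_div_mul_add (a := s - 1) (b := t) (by omega)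
    rw [add_mul]
    omega
  have hε : (1 / 2 / 4 ^ ((s - 1) / t + 1) / 2 : ℝ) < 1 := by
    have : (1 / 2 / 4 ^ ((s - 1) / t + 1) : ℝ) ≤ 1 / 2 :=
      div_le_self (by norm_num) (one_le_pow₀ (by norm_num))
    linarith
  refine ⟨1 / 2 / 4 ^ ((s - 1) / t + 1) / 2, by positivity, tendsto_weakScale hε, fun n => ?_, ?_⟩
  · exact mul_le_of_le_one_left (by positivity) (weakScale_le_one _ n)
  · exact (upperDensity_weakScale_le (by omega) hr hupp).trans_lt
      ((le_upperDensity_ramseyInv_succ (by omega) hr hlow).trans_lt h.2)
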